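/- A \emph{trace map} on a (unital, associative) complex algebra $A$ is a $\mathbb{C}$-linear form $T\colon A\to\mathbb{C}$ such that, for all $x,y\in A$: $T(xy)=T(yx)$; $T(x)=0$ whenever $x$ is nilpotent; and $T(x)$ is a positive real number whenever $0\neq x=x^2$. Let $R$ be a (unital, associative, not necessarily commutative) ring of characteristic $0$ and let $a,b\in R$ satisfy $a^2=b^2=0$. If the complex algebra $\mathbb{C}\otimes_{\mathbb{Z}}R$ has a trace map $T$ such that $|T(1\otimes ab)|\ge 2\,T(1)$, then $1+a$ and $1+b$ are units of $R$ and $(1+a,1+b)$ is a free pair, that is, $1+a$ and $1+b$ freely generate a non-abelian free group (of rank two) inside the group of units of $R$. -/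

import Mathlib

open scoped TensorProduct

/-- A trace map on a complex algebra `A`: a `ℂ`-linear form on `A` that satisfies `T (x * y) = T (y * x)`,
vanishes on nilpotent elements, and is a positive real number at every nonzero idempotent. -/
structure IsTraceMap {A : Type*} [Ring A] [Algebra ℂ A] (T : A →ₗ[ℂ] ℂ) : Prop where
  map_mul_comm : ∀ x y : A, T (x * y) = T (y * x)
  map_nilpotent : ∀ x : A, IsNilpotent x → T x = 0
  map_idempotent : ∀ x : A, x ≠ 0 → x * x = x → ∃ r : ℝ, 0 < r ∧ T x = (r : ℂ)

/-- `(g, h)` is a free pair in the group `G`: the elements `g` and `h` freely generate a free group of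
rank two, i.e. no nontrivial reduced word in two letters becomes trivial at `(g, h)`. -/
def IsFreePair {G : Type*} [Group G] (g h : G) : Prop :=
  Function.Injective (FreeGroup.lift ![g, h] : FreeGroup (Fin 2) →* G)

/-- The subgroup generated by the members of a free pair is free and not abelian. -/
theorem IsFreePair.closure_free {G : Type*} [Group G] {g h : G} (H : IsFreePair g h) :
    IsFreeGroup (Subgroup.closure {g, h}) ∧ g * h ≠ h * g := by
  constructor
  · have hr : (FreeGroup.lift ![g, h] : FreeGroup (Fin 2) →* G).range
        = Subgroup.closure {g, h} := by
      rw [FreeGroup.range_lift_eq_closure, Matrix.range_cons, Matrix.range_cons,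
        Matrix.range_empty, Set.union_empty, Set.singleton_union]
    rw [← hr]
    exact IsFreeGroup.ofMulEquiv (MonoidHom.ofInjective H)
  · intro hc
    have h1 : FreeGroup.of (0 : Fin 2) * FreeGroup.of 1
        = FreeGroup.of (1 : Fin 2) * FreeGroup.of 0 := by
      apply H
      simpa using hc
    revert h1
    decide

/-! In `ℂ ⊗ R` put `c = ab + ba`; it commutes with `a` and `b`, and `T c = 2 T(ab)`, so `‖T c‖ ≥ 4 T
1`. If `c` is algebraic, `T c` is a sum of roots of its minimal polynomial with nonnegative weights
of total `T 1`, so some root `r` has `‖r‖ ≥ 4` (`IsTraceMap.exists_root_of_le`). On the `ℂ[c]`-span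
of `ab` and `bab`, `a` sends `bab` to `c · ab` and `b` sends `ab` to `bab`; both kill the other
generator. Setting `c = r` gives a pair of unipotent 2×2 matrices that play ping-pong
(`isFreePair_of_root`). -/

open scoped Pointwise in
/-- The ping-pong lemma for free groups, in terms of all nonzero powers of the generators. -/
theorem FreeGroup.injective_lift_of_zpow_ping_pong {ι G α : Type*} [Nontrivial ι] [Group G]
    [MulAction G α] (a : ι → G) (X : ι → Set α) (hne : ∀ i, (X i).Nonempty)
    (hdisj : Pairwise fun i j => Disjoint (X i) (X j))
    (hpp : ∀ i j, i ≠ j → ∀ n : ℤ, n ≠ 0 → ∀ x ∈ X j, a i ^ n • x ∈ X i) :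
    Function.Injective (FreeGroup.lift a) := by
  have hlift : FreeGroup.lift a =
      (Monoid.CoprodI.lift fun i => FreeGroup.lift fun _ => a i).comp
        (@freeGroupEquivCoprodI ι).toMonoidHom := by
    ext i
    simp
  rw [hlift, MonoidHom.coe_comp]
  refine Function.Injective.comp ?_ (MulEquiv.injective freeGroupEquivCoprodI)
  refine Monoid.CoprodI.lift_injective_of_ping_pong
    (H := fun _ : ι => FreeGroup Unit) (fun i => FreeGroup.lift fun _ => a i) ?_ X hne hdisj ?_
  -- With only two factors, ping-pong needs a factor with at least three elements; these are
  -- infinite cyclic.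
  · refine Or.inr ⟨Classical.arbitrary ι, ?_⟩
    rw [FreeGroup.freeGroupUnitEquivInt.cardinal_eq, Cardinal.mk_denumerable]
    exact Cardinal.natCast_le_aleph0
  · intro i j hij
    refine FreeGroup.freeGroupUnitEquivInt.forall_congr_left.mpr ?_
    intro n hn
    have hn0 : n ≠ 0 := by
      rintro rfl
      exact hn (by simp [FreeGroup.freeGroupUnitEquivInt])
    change FreeGroup.lift (fun _ => a i) (FreeGroup.of () ^ n) • X j ⊆ X i
    simp only [map_zpow, FreeGroup.lift_apply_of]
    rintro _ ⟨x, hx, rfl⟩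
    exact hpp i j hij n hn0 x hx

/-! ### Square-zero elements and ping-pong -/

section SquareZero

variable {A : Type*} [Ring A]

/-- The unit `1 + a` attached to an element `a` of square zero. -/
def Units.oneAddOfSqZero (a : A) (ha : a ^ 2 = 0) : Aˣ where
  val := 1 + a
  inv := 1 - a
  val_inv := by
    have h : a * a = 0 := by rw [← pow_two, ha]
    simp [mul_sub, add_mul, h]
  inv_val := by
    have h : a * a = 0 := by rw [← pow_two, ha]
    simp [mul_add, sub_mul, h]

theorem Units.val_oneAddOfSqZero (a : A) (ha : a ^ 2 = 0) :
    (Units.oneAddOfSqZero a ha : A) = 1 + a := rfl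

theorem Units.val_zpow_of_sq_zero {a : A} (ha : a ^ 2 = 0) {u : Aˣ} (hu : (u : A) = 1 + a)
    (n : ℤ) : ((u ^ n : Aˣ) : A) = 1 + n • a := by
  have h : a * a = 0 := by rw [← pow_two, ha]
  obtain rfl : u = Units.oneAddOfSqZero a ha := Units.ext hu
  induction n using Int.induction_on with
  | zero => simp
  | succ n ih =>
    rw [zpow_add_one, Units.val_mul, ih, Units.val_oneAddOfSqZero]
    simp only [add_mul, mul_add, smul_mul_assoc, h, add_smul]
    simp [add_assoc, add_comm]
  | pred n ih =>
    rw [zpow_sub_one, Units.val_mul, ih]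
    change _ * (1 - a) = _
    simp only [add_mul, mul_sub, smul_mul_assoc, h, sub_smul]
    simp [sub_eq_add_neg, add_assoc, add_comm]

open Polynomial

variable [Algebra ℂ A]

theorem Commute.aeval_right {x c : A} (h : Commute x c) (p : ℂ[X]) : Commute x (aeval c p) := by
  induction p using Polynomial.induction_on' with
  | add p q hp hq => simpa using hp.add_right hq
  | monomial n z =>
    rw [aeval_monomial]
    exact (Algebra.commute_algebraMap_right z x).mul_right (h.pow_right n)

/-- If `a` and `b` have square zero and some complex number of modulus at least four is a root of
every polynomial that annihilates `a * b + b * a`, then `(1 + a, 1 + b)` is a free pair. -/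
theorem isFreePair_of_root {a b : A} (ha : a ^ 2 = 0) (hb : b ^ 2 = 0) {u v : Aˣ}
    (hu : (u : A) = 1 + a) (hv : (v : A) = 1 + b) (r : ℂ) (hr : 4 ≤ ‖r‖)
    (hroot : ∀ p : ℂ[X], aeval (a * b + b * a) p = 0 → p.eval r = 0) : IsFreePair u v := by
  have haa : ∀ x, a * (a * x) = 0 := fun x => by rw [← mul_assoc, ← pow_two, ha, zero_mul]
  have hbb : ∀ x, b * (b * x) = 0 := fun x => by rw [← mul_assoc, ← pow_two, hb, zero_mul]
  have haa' : a * a = 0 := by rw [← pow_two, ha]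
  have hbb' : b * b = 0 := by rw [← pow_two, hb]
  have hr0 : r ≠ 0 := by
    rintro rfl
    norm_num at hr
  set c := a * b + b * a with hc
  have hca : Commute a c := by
    simp [Commute, SemiconjBy, hc, mul_add, add_mul, mul_assoc, haa, haa']
  have hcb : Commute b c := by
    simp [Commute, SemiconjBy, hc, mul_add, add_mul, mul_assoc, hbb, hbb']
  have hpa := hca.aeval_right
  have hpb := hcb.aeval_right
  -- If `p(c)` kills `ab`, it kills `baba` too, hence `c² = abab + baba`; the extra factor `X²` is
  -- harmless as `r ≠ 0`.
  have hkill : ∀ p : ℂ[X], aeval c p * (a * b) = 0 → p.eval r = 0 := by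
    intro p hp
    have h1 : aeval c p * (b * a * (b * a)) = 0 := by
      calc aeval c p * (b * a * (b * a)) = b * (aeval c p * (a * b)) * a := by
            rw [← mul_assoc b (aeval c p), (hpb p).eq]
            simp only [mul_assoc]
        _ = 0 := by rw [hp, mul_zero, zero_mul]
    have h2 : aeval c (p * X ^ 2) = 0 := by
      have : c ^ 2 = a * b * (a * b) + b * a * (b * a) := by
        simp [hc, pow_two, mul_add, add_mul, mul_assoc, haa, hbb]
      rw [map_mul, map_pow, aeval_X, this, mul_add, h1, ← mul_assoc, hp, zero_mul, add_zero]
    have h3 := hroot _ h2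
    simpa [hr0] using h3
  let φ : ℂ[X] → ℂ[X] → A := fun x y => aeval c x * (a * b) + aeval c y * (b * (a * b))
  have hφa : ∀ x y, a * φ x y = φ (X * y) 0 := by
    intro x y
    have h1 : a * (aeval c x * (a * b)) = 0 := by
      rw [← mul_assoc, (hpa x).eq, mul_assoc, haa, mul_zero]
    have h2 : a * (aeval c y * (b * (a * b))) = aeval c y * (c * (a * b)) := by
      rw [← mul_assoc, (hpa y).eq]
      simp [hc, add_mul, mul_assoc, haa]
    have h3 : Commute (aeval c y) c := (Commute.refl c).aeval_right y |>.symm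
    simp only [φ, mul_add, h1, h2, map_mul, aeval_X, map_zero, zero_mul, zero_add, add_zero]
    rw [← mul_assoc, h3.eq]
  have hφb : ∀ x y, b * φ x y = φ 0 x := by
    intro x y
    have h1 : b * (aeval c x * (a * b)) = aeval c x * (b * (a * b)) := by
      rw [← mul_assoc, (hpb x).eq, mul_assoc]
    have h2 : b * (aeval c y * (b * (a * b))) = 0 := by
      rw [← mul_assoc, (hpb y).eq, mul_assoc, hbb, mul_zero]
    simp only [φ, mul_add, h1, h2, map_zero, zero_mul, zero_add, add_zero]
  have hφadd : ∀ x y x' y', φ x y + φ x' y' = φ (x + x') (y + y') := by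
    intro x y x' y'
    simp only [φ, map_add, add_mul]
    abel
  have hφsmul : ∀ (n : ℤ) x y, n • φ x y = φ (n • x) (n • y) := by
    intro n x y
    simp only [φ, map_zsmul, smul_add, smul_mul_assoc]
  have hφ0 : ∀ x y, φ x y = 0 → x.eval r = 0 ∧ y.eval r = 0 := by
    have key : ∀ x, φ x 0 = 0 → x.eval r = 0 := fun x h => hkill x (by simpa [φ] using h)
    intro x y h
    constructor
    · have := key (X * x) (by rw [← hφa 0 x, ← hφb x y, h, mul_zero, mul_zero])
      simpa [hr0] using this
    · have := key (X * y) (by rw [← hφa x y, h, mul_zero])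
      simpa [hr0] using this
  -- The coordinates `x`, `y` need not be unique, but their values at `r` are.
  have hφinj : ∀ x y x' y', φ x y = φ x' y' → x.eval r = x'.eval r ∧ y.eval r = y'.eval r := by
    intro x y x' y' h
    have h0 := hφ0 (x - x') (y - y') (by
      rw [← sub_eq_zero] at h
      rw [← h]
      simp only [φ, map_sub, sub_mul]
      abel)
    simpa [sub_eq_zero] using h0
  have hn1 : ∀ n : ℤ, n ≠ 0 → 1 ≤ ‖(n : ℂ)‖ := fun n hn => by
    rw [Complex.norm_intCast]
    exact_mod_cast Int.one_le_abs hn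
  -- The slope 2 balances both moves: `‖x + nry‖ > 4‖y‖ - 2‖y‖` on `Q`, and `‖y + nx‖ > ‖x‖ - ‖x‖/2`
  -- on `P`.
  let P : Set A := {w | ∃ x y, w = φ x y ∧ 2 * ‖y.eval r‖ < ‖x.eval r‖}
  let Q : Set A := {w | ∃ x y, w = φ x y ∧ ‖x.eval r‖ < 2 * ‖y.eval r‖}
  have hPQ : Disjoint P Q := by
    rw [Set.disjoint_left]
    rintro _ ⟨x, y, rfl, h⟩ ⟨x', y', h', h''⟩
    obtain ⟨hx, hy⟩ := hφinj _ _ _ _ h'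
    rw [hx, hy] at h
    exact lt_asymm h h''
  have hu' : ∀ n : ℤ, n ≠ 0 → ∀ w ∈ Q, u ^ n • w ∈ P := by
    rintro n hn _ ⟨x, y, rfl, h⟩
    refine ⟨x + n • (X * y), y, ?_, ?_⟩
    · rw [Units.smul_def, Units.val_zpow_of_sq_zero ha hu, smul_eq_mul, add_mul, one_mul,
        smul_mul_assoc, hφa, hφsmul, hφadd, smul_zero, add_zero]
    · have h1 : 4 * ‖y.eval r‖ ≤ ‖(n • (X * y)).eval r‖ := by
        rw [zsmul_eq_mul, eval_mul, eval_mul, eval_X, eval_intCast, norm_mul, norm_mul]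
        nlinarith [mul_le_mul (hn1 n hn) hr (by norm_num) (norm_nonneg _),
          norm_nonneg (y.eval r)]
      have h2 := norm_sub_le (x.eval r + (n • (X * y)).eval r) (x.eval r)
      rw [add_sub_cancel_left] at h2
      rw [eval_add]
      linarith
  have hv' : ∀ n : ℤ, n ≠ 0 → ∀ w ∈ P, v ^ n • w ∈ Q := by
    rintro n hn _ ⟨x, y, rfl, h⟩
    refine ⟨x, y + n • x, ?_, ?_⟩
    · rw [Units.smul_def, Units.val_zpow_of_sq_zero hb hv, smul_eq_mul, add_mul, one_mul,
        smul_mul_assoc, hφb, hφsmul, hφadd, smul_zero, add_zero]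
    · have h1 : ‖x.eval r‖ ≤ ‖(n • x).eval r‖ := by
        rw [zsmul_eq_mul, eval_mul, eval_intCast, norm_mul]
        exact le_mul_of_one_le_left (norm_nonneg _) (hn1 n hn)
      have h2 := norm_sub_le (y.eval r + (n • x).eval r) (y.eval r)
      rw [add_sub_cancel_left] at h2
      rw [eval_add]
      linarith
  refine FreeGroup.injective_lift_of_zpow_ping_pong ![u, v] ![P, Q] ?_ ?_ ?_
  · refine Fin.forall_fin_two.2 ⟨⟨φ 1 0, 1, 0, rfl, ?_⟩, ⟨φ 0 1, 0, 1, rfl, ?_⟩⟩ <;> simp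
  · intro i j hij
    fin_cases i <;> fin_cases j
    · exact absurd rfl hij
    · exact hPQ
    · exact hPQ.symm
    · exact absurd rfl hij
  · intro i j hij
    fin_cases i <;> fin_cases j
    · exact absurd rfl hij
    · exact hu'
    · exact hv'
    · exact absurd rfl hij

end SquareZero

/-! ### Trace maps and spectral bounds -/

section TraceMap

open Polynomial

variable {A : Type*} [Ring A] [Algebra ℂ A]

/-- An element `x` with `x * x - x` nilpotent differs from some idempotent by a nilpotent. -/
theorem exists_idempotent_sub_nilpotent {x : A} (hx : IsNilpotent (x * x - x)) :
    ∃ e : A, e * e = e ∧ IsNilpotent (x - e) := by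
  -- In this commutative subalgebra the nilpotents form an ideal, modulo which idempotents lift.
  let B := Algebra.adjoin ℂ {x}
  have : IsMulCommutative B := Algebra.isMulCommutative_adjoin ℂ (by simp)
  let _ : CommRing B := inferInstance
  let y : B := ⟨x, Algebra.self_mem_adjoin_singleton ℂ x⟩
  have hinj : Function.Injective (B.val : B →+* A) := Subtype.val_injective
  let f := Ideal.Quotient.mk (nilradical B)
  have hy : IsNilpotent (y * y - y) := by
    obtain ⟨n, hn⟩ := hx
    exact ⟨n, hinj (by simpa [y] using hn)⟩
  obtain ⟨e, he, hfe⟩ := exists_isIdempotentElem_eq_of_ker_isNilpotent f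
    (fun z hz => by rwa [Ideal.mk_ker, mem_nilradical] at hz) (f y) ⟨y, rfl⟩ (by
      rw [IsIdempotentElem, ← sub_eq_zero, ← map_mul, ← map_sub]
      exact Ideal.Quotient.eq_zero_iff_mem.2 hy)
  refine ⟨e, congrArg Subtype.val he.eq, ?_⟩
  have h : IsNilpotent (y - e) := Ideal.Quotient.eq.1 hfe.symm
  exact h.map (B.val : B →+* A)

theorem IsTraceMap.nonneg_of_sub_nilpotent {T : A →ₗ[ℂ] ℂ} (hT : IsTraceMap T) {x : A}
    (hx : IsNilpotent (x * x - x)) : ∃ s : ℝ, 0 ≤ s ∧ T x = (s : ℂ) := by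
  obtain ⟨e, he, hn⟩ := exists_idempotent_sub_nilpotent hx
  have h : T x = T e := by
    rw [← sub_eq_zero, ← map_sub, hT.map_nilpotent _ hn]
  rw [h]
  by_cases he0 : e = 0
  · exact ⟨0, le_rfl, by simp [he0]⟩
  · obtain ⟨s, hs, hTs⟩ := hT.map_idempotent e he0 he
    exact ⟨s, hs.le, hTs⟩

/-- A nonzero complex polynomial `m` divides a power of every polynomial that vanishes at all roots
of `m`. -/
theorem Polynomial.exists_dvd_pow_of_forall_isRoot {m : ℂ[X]} (hm : m ≠ 0) {p : ℂ[X]}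
    (hp : ∀ z, m.IsRoot z → p.eval z = 0) : ∃ n, m ∣ p ^ n := by
  refine ⟨m.roots.card, ?_⟩
  have hs := (IsAlgClosed.splits m).eq_prod_roots
  have h1 : (m.roots.map fun z => X - C z).prod ∣ (m.roots.map fun _ => p).prod :=
    Multiset.prod_dvd_prod_of_dvd _ _ fun z hz =>
      dvd_iff_isRoot.2 (hp z ((mem_roots hm).1 hz))
  rw [Multiset.map_const', Multiset.prod_replicate] at h1
  refine hs.dvd.trans ?_
  exact (isUnit_C.2 (leadingCoeff_ne_zero.2 hm).isUnit).mul_left_dvd.2 h1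

/-- If `k * T 1 ≤ ‖T c‖`, then some complex number of modulus at least `k` is a root of every
polynomial that annihilates `c`. -/
theorem IsTraceMap.exists_root_of_le {T : A →ₗ[ℂ] ℂ} (hT : IsTraceMap T) [Nontrivial A] (c : A)
    {k : ℝ} (hk : k * (T 1).re ≤ ‖T c‖) :
    ∃ r : ℂ, k ≤ ‖r‖ ∧ ∀ p : ℂ[X], aeval c p = 0 → p.eval r = 0 := by
  obtain ⟨t, ht, hTt⟩ := hT.map_idempotent 1 one_ne_zero (one_mul 1)
  by_cases hc : Transcendental ℂ c
  · refine ⟨(|k| : ℝ), by simpa using le_abs_self k, fun p hp => ?_⟩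
    rw [transcendental_iff.1 hc p hp, eval_zero]
  have hint : IsIntegral ℂ c := (not_not.1 hc : IsAlgebraic ℂ c).isIntegral
  by_contra! hcon
  set m := minpoly ℂ c with hm
  have hm0 : m ≠ 0 := minpoly.ne_zero hint
  have hlt : ∀ z, m.IsRoot z → ‖z‖ < k := by
    intro z hz
    by_contra! hkz
    obtain ⟨p, hp, hpz⟩ := hcon z hkz
    exact hpz (hz.dvd (minpoly.dvd ℂ c hp))
  have hnil : ∀ p : ℂ[X], (∀ z, m.IsRoot z → p.eval z = 0) → IsNilpotent (aeval c p) := by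
    intro p hp
    obtain ⟨n, q, hq⟩ := exists_dvd_pow_of_forall_isRoot hm0 hp
    exact ⟨n, by rw [← map_pow, hq, map_mul, minpoly.aeval, zero_mul]⟩
  let S := m.roots.toFinset
  have hS : ∀ z, m.IsRoot z ↔ z ∈ S := fun z => by simp [S, hm0]
  have hSne : S.Nonempty := by
    obtain ⟨z, hz⟩ := IsAlgClosed.exists_root m (minpoly.degree_pos hint).ne'
    exact ⟨z, (hS z).1 hz⟩
  have hinj : Set.InjOn id (S : Set ℂ) := Set.injOn_id _
  -- Modulo nilpotents, the `L z` evaluated at `c` are the spectral idempotents of `c`; their traces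
  -- are the weights `s z`.
  let L : ℂ → ℂ[X] := fun z => Lagrange.basis S id z
  have hL : ∀ z ∈ S, ∀ w ∈ S, (L z).eval w = if z = w then 1 else 0 := by
    intro z hz w hw
    split_ifs with h
    · subst h
      exact Lagrange.eval_basis_self hinj hz
    · exact Lagrange.eval_basis_of_ne (v := (id : ℂ → ℂ)) h hw
  have hTL : ∀ z : S, ∃ s : ℝ, 0 ≤ s ∧ T (aeval c (L z)) = (s : ℂ) := by
    rintro ⟨z, hz⟩
    refine hT.nonneg_of_sub_nilpotent ?_
    rw [← map_mul, ← map_sub]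
    refine hnil _ fun w hw => ?_
    rw [eval_sub, eval_mul, hL z hz w ((hS w).1 hw)]
    split_ifs <;> simp
  choose s hs0 hs using hTL
  have hsum : t = ∑ z : S, s z := by
    have h1 : T 1 = ∑ z : S, T (aeval c (L z)) := by
      rw [← map_sum, ← map_sum, Finset.sum_coe_sort S L, Lagrange.sum_basis hinj hSne,
        aeval_one]
    rw [hTt] at h1
    simp only [hs] at h1
    exact_mod_cast h1
  have hTc : T c = ∑ z : S, (z : ℂ) * s z := by
    have h1 : IsNilpotent (aeval c (X - ∑ z ∈ S, C z * L z)) := by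
      refine hnil _ fun w hw => ?_
      have hw' := (hS w).1 hw
      rw [eval_sub, eval_X, eval_finsetSum, Finset.sum_eq_single w]
      · rw [eval_mul, eval_C, hL w hw' w hw', if_pos rfl, mul_one, sub_self]
      · intro z hz hzw
        rw [eval_mul, hL z hz w hw', if_neg hzw, mul_zero]
      · exact fun h => absurd hw' h
    have h2 := hT.map_nilpotent _ h1
    rw [map_sub, map_sub, sub_eq_zero, aeval_X, ← Finset.sum_coe_sort, map_sum, map_sum] at h2
    rw [h2]
    refine Finset.sum_congr rfl fun z _ => ?_
    rw [C_mul', map_smul, map_smul, hs, smul_eq_mul]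
  -- A positive weight is what makes the final estimate strict.
  obtain ⟨z₀, hz₀⟩ : ∃ z : S, 0 < s z := by
    by_contra! h
    exact absurd (hsum ▸ Finset.sum_nonpos fun z _ => h z) (not_le.2 ht)
  have hlast : ‖T c‖ < k * t := by
    calc ‖T c‖ ≤ ∑ z : S, ‖(z : ℂ) * s z‖ := hTc ▸ norm_sum_le _ _
      _ = ∑ z : S, ‖(z : ℂ)‖ * s z := by
        refine Finset.sum_congr rfl fun z _ => ?_
        rw [norm_mul, Complex.norm_real, Real.norm_of_nonneg (hs0 z)]
      _ < ∑ z : S, k * s z := by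
        refine Finset.sum_lt_sum (fun z _ => ?_) ⟨z₀, Finset.mem_univ _, ?_⟩
        · exact mul_le_mul_of_nonneg_right (hlt z ((hS z).2 z.2)).le (hs0 z)
        · exact mul_lt_mul_of_pos_right (hlt z₀ ((hS z₀).2 z₀.2)) hz₀
      _ = k * t := by rw [hsum, Finset.mul_sum]
  rw [hTt, Complex.ofReal_re] at hk
  exact absurd hk (not_le.2 hlast)

end TraceMap

theorem IsFreePair.of_map {G H : Type*} [Group G] [Group H] (f : G →* H) {g h : G}
    (hf : IsFreePair (f g) (f h)) : IsFreePair g h := by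
  have hcomp : (FreeGroup.lift ![f g, f h] : FreeGroup (Fin 2) →* H)
      = f.comp (FreeGroup.lift ![g, h]) := by
    ext i
    fin_cases i <;> simp
  have hf' : Function.Injective (FreeGroup.lift ![f g, f h] : FreeGroup (Fin 2) →* H) := hf
  rw [hcomp, MonoidHom.coe_comp] at hf'
  exact hf'.of_comp

theorem mainTheorem8 {R : Type*} [Ring R] [CharZero R] (a b : R)
    (ha : a ^ 2 = 0) (hb : b ^ 2 = 0)
    (T : ℂ ⊗[ℤ] R →ₗ[ℂ] ℂ) (hT : IsTraceMap T)
    (hab : 2 * (T 1).re ≤ ‖T ((1 : ℂ) ⊗ₜ[ℤ] (a * b))‖) :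
    ∃ u v : Rˣ, (u : R) = 1 + a ∧ (v : R) = 1 + b ∧ IsFreePair u v := by
  -- Characteristic 0 enters here: `ℤ → R` stays injective after tensoring with the flat module `ℂ`.
  have : Nontrivial (ℂ ⊗[ℤ] R) :=
    (Algebra.TensorProduct.includeLeft_injective (R := ℤ) (S := ℤ) (A := ℂ) (B := R)
      (by simpa using (Int.cast_injective : Function.Injective (Int.cast : ℤ → R)))).nontrivial
  let ι : R →+* ℂ ⊗[ℤ] R :=
    (Algebra.TensorProduct.includeRight : R →ₐ[ℤ] ℂ ⊗[ℤ] R).toRingHom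
  have hιab : (1 : ℂ) ⊗ₜ[ℤ] (a * b) = ι a * ι b := by
    rw [← map_mul]
    rfl
  have hTc : 4 * (T 1).re ≤ ‖T (ι a * ι b + ι b * ι a)‖ := by
    rw [hιab] at hab
    rw [map_add, hT.map_mul_comm (ι b), ← two_mul, norm_mul, Complex.norm_ofNat]
    linarith
  obtain ⟨r, hr, hroot⟩ := hT.exists_root_of_le _ hTc
  refine ⟨Units.oneAddOfSqZero a ha, Units.oneAddOfSqZero b hb, rfl, rfl, ?_⟩
  -- `ι` need not be injective: a relation in `R` would persist in the image.
  refine IsFreePair.of_map (Units.map (ι : R →* ℂ ⊗[ℤ] R)) ?_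
  refine isFreePair_of_root (a := ι a) (b := ι b) (by rw [← map_pow, ha, map_zero])
    (by rw [← map_pow, hb, map_zero]) ?_ ?_ r hr hroot
  · simp [Units.val_oneAddOfSqZero]
  · simp [Units.val_oneAddOfSqZero]
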